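/- There are $n$ agents and $d$ topics; $x_{i,p}(t)\in\mathbb R$ is the opinion of agent $i$ on topic $p$ and $x_i=(x_{i,1},\dots,x_{i,d})^T$. For agents $i,j$ let $K^{i,j}=[k^{i,j}_{p,q}]\in\mathbb R^{d\times d}$ be constant coupling matrices with $k^{i,j}_{p,q}\ge 0$ and $k^{i,j}_{p,q}=k^{j,i}_{p,q}=k^{i,j}_{q,p}$ (cooperative couplings); the $K^{i,j}$ are not assumed to be positive semidefinite. Let $\mathcal N_i$ be the set of agents $j\ne i$ with $K^{i,j}\neq 0$. The opinions evolve by $$\dot x_i=\sum_{j\in\mathcal N_i}A^{i,j}(x)\,(x_j-x_i),\qquad A^{i,j}=[a^{i,j}_{p,q}].$$ Here $s:\mathbb R\to\mathbb R$ is a continuous sign function, either the sigmoid $s(z)=\frac{2}{1+e^{-k_e z}}-1$ with $k_e>0$, or $s(z)=\operatorname{sgn}(z)|z|^\alpha$ with $0<\alpha<1$. Writing $u_p=x_{j,p}-x_{i,p}$, the weights are given by one of the following two feedback laws. * Inverse-proportional feedback: $a^{i,j}_{p,q}=k^{i,j}_{p,q}\,s(u_p)\,s(u_q)$ for $p\ne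 q$, and either $a^{i,j}_{p,p}=k^{i,j}_{p,p}$ for all $i,j,p$, or $a^{i,j}_{p,p}=k^{i,j}_{p,p}\,s(u_p)^2$ for all $i,j,p$. * Proportional feedback, with constants $c_0,c_1>0$ and $c_2\ge 0$: $a^{i,j}_{p,q}=\dfrac{k^{i,j}_{p,q}\,s(u_p)\,s(u_q)}{(c_1|u_p|+c_0)(c_1|u_q|+c_0)}$ for $p\neq q$, and either $a^{i,j}_{p,p}=\dfrac{k^{i,j}_{p,p}}{c_2|u_p|^2+c_1|u_p|+c_0}$ for all $i,j,p$, or $a^{i,j}_{p,p}=\dfrac{k^{i,j}_{p,p}\,s(u_p)^2}{(c_1|u_p|+c_0)^2}$ for all $i,j,p$. For each topic $p$ let $\mathcal G_p$ be the graph on the agents in which $i\neq j$ are adjacent if and only if $k^{i,j}_{p,p}\ne 0$. Suppose that the network is all-topic coupled, i.e. $\mathcal G_p$ is connected for every $p\in\{1,\dots,d\}$. Then every solution on $[t_0,\infty)$ reaches a complete opinion consensus: there is $c\in\mathbb R^d$ such that $x_{i,p}(t)\to c_p$ as $t\to\infty$ for every agent $i$ and every topic $p$; in particular $x_{j,p}(t)-x_{i,p}(t)\to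 0$ for all $i,j,p$. -/

import Mathlib

open Filter Topology

namespace OpinionDynamics

noncomputable section

/-- An opinion profile: `x i p` is the opinion of agent `i` on topic `p`. -/
abbrev Profile (n d : ℕ) : Type := Fin n → Fin d → ℝ

/-- A family of constant coupling matrices: `K i j p q` is the gain `k_{p,q}^{i,j}`. -/
abbrev Coupling (n d : ℕ) : Type := Fin n → Fin n → Matrix (Fin d) (Fin d) ℝ

/-- Cooperative couplings: every gain is nonnegative (it is positive when the coupling is present
and zero when it is absent), and the gains are symmetric in the agents and in the topics.
No definiteness of the matrices `K i j` is required. -/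
structure IsCooperative {n d : ℕ} (K : Coupling n d) : Prop where
  nonneg : ∀ i j p q, 0 ≤ K i j p q
  symm_agents : ∀ i j p q, K i j p q = K j i p q
  symm_topics : ∀ i j p q, K i j p q = K i j q p

/-- The interaction graph: two distinct agents are adjacent when their coupling matrix is
nonzero. -/
def interactionGraph {n d : ℕ} (K : Coupling n d) : SimpleGraph (Fin n) :=
  SimpleGraph.fromRel fun i j => K i j ≠ 0

/-- The graph of topic `p`: two distinct agents are adjacent when they are directly coupled on
topic `p`. -/
def topicGraph {n d : ℕ} (K : Coupling n d) (p : Fin d) : SimpleGraph (Fin n) :=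
  SimpleGraph.fromRel fun i j => K i j p p ≠ 0

/-- The network is `p`-coupled when the graph of topic `p` is connected. -/
def IsTopicCoupled {n d : ℕ} (K : Coupling n d) (p : Fin d) : Prop :=
  (topicGraph K p).Connected

/-- The network is all-topic coupled when it is `p`-coupled for every topic `p`. -/
def IsAllTopicCoupled {n d : ℕ} (K : Coupling n d) : Prop :=
  ∀ p, IsTopicCoupled K p

/-- The continuous sign functions: the sigmoid of steepness `ke`, and the signum power function
of exponent `α`. -/
inductive SignFunction : Type
  | sigmoid (ke : ℝ) (hke : 0 < ke) : SignFunction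
  | signumPower (α : ℝ) (hα₀ : 0 < α) (hα₁ : α < 1) : SignFunction

/-- The value of a sign function at a real number. -/
def SignFunction.eval : SignFunction → ℝ → ℝ
  | .sigmoid ke _, z => 2 / (1 + Real.exp (-ke * z)) - 1
  | .signumPower α _ _, z => Real.sign z * |z| ^ α

/-- The two feedback laws. -/
inductive Feedback : Type
  | inverseProportional : Feedback
  | proportional (c₀ c₁ c₂ : ℝ) (hc₀ : 0 < c₀) (hc₁ : 0 < c₁) (hc₂ : 0 ≤ c₂) : Feedback

/-- The formula for the weight of the direct coupling of a topic with itself: either the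
separate sign-free formula, or the formula of the cross couplings read at `q = p`. -/
inductive DiagonalForm : Type
  | direct : DiagonalForm
  | asCross : DiagonalForm

/-- Weight of the coupling of two topics with gain `k`, where `u` and `v` are the opinion
differences on the two topics. -/
def Feedback.crossWeight (s : SignFunction) : Feedback → ℝ → ℝ → ℝ → ℝ
  | .inverseProportional, k, u, v => k * s.eval u * s.eval v
  | .proportional c₀ c₁ _ _ _ _, k, u, v =>
      k * s.eval u * s.eval v / ((c₁ * |u| + c₀) * (c₁ * |v| + c₀))

/-- Sign-free weight of the coupling of a topic with itself, with gain `k`, where `u` is the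
opinion difference on this topic. -/
def Feedback.directWeight : Feedback → ℝ → ℝ → ℝ
  | .inverseProportional, k, _ => k
  | .proportional c₀ c₁ c₂ _ _ _, k, u => k / (c₂ * |u| ^ 2 + c₁ * |u| + c₀)

/-- Weight of the coupling of a topic with itself. -/
def Feedback.diagonalWeight (s : SignFunction) (F : Feedback) : DiagonalForm → ℝ → ℝ → ℝ
  | .direct, k, u => F.directWeight k u
  | .asCross, k, u => F.crossWeight s k u u

/-- The state-dependent weighting matrix `A^{i,j}`. -/
def weight {n d : ℕ} (F : Feedback) (D : DiagonalForm) (s : SignFunction) (K : Coupling n d)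
    (x : Profile n d) (i j : Fin n) : Matrix (Fin d) (Fin d) ℝ :=
  Matrix.of fun p q =>
    if p = q then F.diagonalWeight s D (K i j p p) (x j p - x i p)
    else F.crossWeight s (K i j p q) (x j p - x i p) (x j q - x i q)

open Classical in
/-- The right-hand side of the opinion dynamics:
agent `i` moves with velocity `∑ A^{i,j} (x_j - x_i)`, the sum over the neighbours `j` of `i`. -/
def velocity {n d : ℕ} (F : Feedback) (D : DiagonalForm) (s : SignFunction) (K : Coupling n d)
    (x : Profile n d) : Profile n d :=
  fun i => ∑ j with (interactionGraph K).Adj i j, (weight F D s K x i j).mulVec (x j - x i)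

/-- `x` solves the opinion dynamics on `[t₀, ∞)` (with a one-sided derivative at `t₀`). -/
def IsSolution {n d : ℕ} (F : Feedback) (D : DiagonalForm) (s : SignFunction) (K : Coupling n d)
    (t₀ : ℝ) (x : ℝ → Profile n d) : Prop :=
  ∀ t ∈ Set.Ici t₀, HasDerivWithinAt x (velocity F D s K (x t)) (Set.Ici t₀) t

/-- Complete opinion consensus: on every topic, the opinions of all agents converge to one
common value. In particular `x_{j,p} - x_{i,p}` tends to `0` for all `i`, `j` and `p`. -/
def ReachesCompleteConsensus {n d : ℕ} (x : ℝ → Profile n d) : Prop :=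
  ∃ c : Fin d → ℝ, ∀ i p, Tendsto (fun t => x t i p) atTop (𝓝 (c p))

end

end OpinionDynamics

/-!
The squared distance `V = ∑ (x i p - m p) ^ 2` to the profile in which every agent holds the mean
opinion `m` is a strict Lyapunov function.

Since sign functions are odd and the gains are symmetric in the agents, the influence
`A^{i,j} (x_j - x_i)` is antisymmetric in `i` and `j`. Hence the mean `m` is conserved
(`sum_velocity_apply_eq_zero`) and `dV/dt = -∑ ⟪u, A^{i,j} u⟫` with `u = x_j - x_i`. As `s(z) z ≥ 0`
and the gains are nonnegative, every summand `u_p A^{i,j}_{p,q} u_q` of this quadratic form is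
nonnegative, so dropping the cross couplings gives `dV/dt ≤ -W`, where the `dissipation` `W`
collects the diagonal terms only (`two_mul_sum_mul_velocity_le`). Definiteness of the coupling
matrices plays no role.

When all topic graphs are connected, `W` vanishes only at consensus profiles
(`dissipation_pos`). It is continuous, so it is bounded below by a positive constant on the compact
set of profiles with mean `m` and `ε ≤ V ≤ V(t₀)`. A solution staying there forever would
make `V` decrease linearly to `-∞`; thus `V`, which is nonincreasing, tends to `0`.
-/

namespace OpinionDynamics

/-! ### Sign functions -/

namespace SignFunction

variable (s : SignFunction)

lemma eval_neg (u : ℝ) : s.eval (-u) = -s.eval u := by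
  cases s with
  | sigmoid ke hke =>
    have h : Real.exp (-ke * -u) = (Real.exp (-ke * u))⁻¹ := by
      rw [← Real.exp_neg]; ring_nf
    have hpos := Real.exp_pos (-ke * u)
    simp only [eval, h]
    field_simp
    ring
  | signumPower α h₀ h₁ =>
    simp only [eval, abs_neg, Real.sign_neg, neg_mul]

lemma eval_pos {u : ℝ} (hu : 0 < u) : 0 < s.eval u := by
  cases s with
  | sigmoid ke hke =>
    have hpos := Real.exp_pos (-ke * u)
    have hlt : Real.exp (-ke * u) < 1 := by
      rw [Real.exp_lt_one_iff]
      nlinarith [mul_pos hke hu]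
    simp only [eval]
    rw [sub_pos, lt_div_iff₀ (by positivity)]
    linarith
  | signumPower α h₀ h₁ =>
    simp only [eval, Real.sign_of_pos hu, one_mul]
    exact Real.rpow_pos_of_pos (abs_pos.2 hu.ne') _

lemma eval_mul_self_nonneg (u : ℝ) : 0 ≤ s.eval u * u := by
  rcases lt_trichotomy u 0 with hu | rfl | hu
  · have h := s.eval_pos (neg_pos.2 hu)
    rw [eval_neg] at h
    nlinarith
  · simp
  · exact (mul_pos (s.eval_pos hu) hu).le

lemma eval_ne_zero {u : ℝ} (hu : u ≠ 0) : s.eval u ≠ 0 := by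
  rcases lt_or_gt_of_ne hu with hu | hu
  · have h := s.eval_pos (neg_pos.2 hu)
    rw [eval_neg] at h
    linarith
  · exact (s.eval_pos hu).ne'

/-- Only squares of sign functions enter the dissipation, which spares a discussion of the jump of
the signum at `0`. -/
lemma continuous_eval_mul_eval : Continuous fun u => s.eval u * s.eval u := by
  cases s with
  | sigmoid ke hke =>
    have h : Continuous fun u : ℝ => 2 / (1 + Real.exp (-ke * u)) - 1 :=
      (continuous_const.div (by fun_prop) fun u => by positivity).sub continuous_const
    exact h.mul h
  | signumPower α h₀ h₁ =>
    have h : Continuous fun u : ℝ => |u| ^ α := continuous_abs.rpow_const fun _ => Or.inr h₀.le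
    refine (h.mul h).congr fun u => ?_
    rcases lt_trichotomy u 0 with hu | rfl | hu
    · simp [eval, Real.sign_of_neg hu]
    · simp [eval, Real.zero_rpow h₀.ne']
    · simp [eval, Real.sign_of_pos hu]

end SignFunction

/-! ### Weights -/

namespace Feedback

variable (F : Feedback) (D : DiagonalForm) (s : SignFunction)

lemma crossWeight_neg (k u v : ℝ) : F.crossWeight s k (-u) (-v) = F.crossWeight s k u v := by
  cases F <;> simp [crossWeight, SignFunction.eval_neg]

lemma diagonalWeight_neg (k u : ℝ) : F.diagonalWeight s D k (-u) = F.diagonalWeight s D k u := by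
  cases D with
  | direct => cases F <;> simp [diagonalWeight, directWeight]
  | asCross => exact F.crossWeight_neg s k u u

@[simp]
lemma crossWeight_zero (u v : ℝ) : F.crossWeight s 0 u v = 0 := by
  cases F <;> simp [crossWeight]

@[simp]
lemma diagonalWeight_zero (u : ℝ) : F.diagonalWeight s D 0 u = 0 := by
  cases D with
  | direct => cases F <;> simp [diagonalWeight, directWeight]
  | asCross => exact F.crossWeight_zero s u u

lemma mul_crossWeight_mul_nonneg {k : ℝ} (hk : 0 ≤ k) (u v : ℝ) :
    0 ≤ u * (F.crossWeight s k u v * v) := by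
  have h : 0 ≤ k * (s.eval u * u) * (s.eval v * v) :=
    mul_nonneg (mul_nonneg hk (s.eval_mul_self_nonneg u)) (s.eval_mul_self_nonneg v)
  cases F with
  | inverseProportional =>
    simp only [crossWeight]
    linarith
  | proportional c₀ c₁ c₂ hc₀ hc₁ hc₂ =>
    have e : u * (crossWeight s (.proportional c₀ c₁ c₂ hc₀ hc₁ hc₂) k u v * v) =
        k * (s.eval u * u) * (s.eval v * v) / ((c₁ * |u| + c₀) * (c₁ * |v| + c₀)) := by
      simp only [crossWeight]
      ring
    rw [e]
    positivity

lemma diagonalWeight_pos {k u : ℝ} (hk : 0 < k) (hu : u ≠ 0) : 0 < F.diagonalWeight s D k u := by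
  have h : 0 < k * s.eval u * s.eval u := by
    rw [mul_assoc]
    exact mul_pos hk (mul_self_pos.2 (s.eval_ne_zero hu))
  cases D <;> cases F <;> simp only [diagonalWeight, directWeight, crossWeight] <;> positivity

lemma diagonalWeight_mul_sq_nonneg {k : ℝ} (hk : 0 ≤ k) (u : ℝ) :
    0 ≤ F.diagonalWeight s D k u * u ^ 2 := by
  rcases hk.eq_or_lt with rfl | hk
  · simp
  rcases eq_or_ne u 0 with rfl | hu
  · simp
  exact mul_nonneg (F.diagonalWeight_pos D s hk hu).le (sq_nonneg u)

lemma continuous_diagonalWeight (k : ℝ) : Continuous (F.diagonalWeight s D k) := by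
  cases D with
  | direct =>
    cases F with
    | inverseProportional => exact continuous_const
    | proportional c₀ c₁ c₂ hc₀ hc₁ hc₂ =>
      exact continuous_const.div (by fun_prop) fun u => by positivity
  | asCross =>
    have h : Continuous fun u => k * s.eval u * s.eval u := by
      simp only [mul_assoc]
      exact continuous_const.mul s.continuous_eval_mul_eval
    cases F with
    | inverseProportional => exact h
    | proportional c₀ c₁ c₂ hc₀ hc₁ hc₂ =>
      exact h.div (by fun_prop) fun u => by positivity

end Feedback

/-! ### Mutual influences and energy dissipation -/

section Dissipation

variable {n d : ℕ} (F : Feedback) (D : DiagonalForm) (s : SignFunction) (K : Coupling n d)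

/-- The influence `A^{i,j} (x_j - x_i)` of agent `j` on agent `i`. -/
noncomputable def influence (x : Profile n d) (i j : Fin n) : Fin d → ℝ :=
  (weight F D s K x i j).mulVec (x j - x i)

/-- The part of the energy dissipation that is due to the coupling of each topic with itself:
`∑ a^{i,j}_{p,p} (x_{j,p} - x_{i,p})²`. -/
noncomputable def dissipation (x : Profile n d) : ℝ :=
  ∑ i, ∑ j, ∑ p, F.diagonalWeight s D (K i j p p) (x j p - x i p) * (x j p - x i p) ^ 2

variable {K} in
lemma influence_antisymm (hK : IsCooperative K) (x : Profile n d) (i j : Fin n) :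
    influence F D s K x j i = -influence F D s K x i j := by
  have hw : weight F D s K x j i = weight F D s K x i j := by
    ext p q
    simp only [weight, Matrix.of_apply, hK.symm_agents j i, ← neg_sub (x j _) (x i _),
      Feedback.diagonalWeight_neg, Feedback.crossWeight_neg]
  rw [influence, influence, hw, ← neg_sub (x j), Matrix.mulVec_neg]

/-- Agents that are not neighbours exert no influence, so the sum over the neighbours may be
extended to all agents. -/
lemma velocity_eq_sum_influence (x : Profile n d) (i : Fin n) :
    velocity F D s K x i = ∑ j, influence F D s K x i j := by
  classical
  simp only [velocity]
  refine Finset.sum_subset (Finset.filter_subset _ _) fun j _ hj => ?_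
  rcases eq_or_ne i j with rfl | hij
  · simp
  have hKij : K i j = 0 := by
    by_contra h
    exact hj (by simp [interactionGraph, SimpleGraph.fromRel_adj, hij, h])
  have hw : weight F D s K x i j = 0 := by
    ext p q
    simp [weight, hKij]
  simp [hw]

variable {K}

/-- The drift of a quantity `∑ y i p * x i p` along the flow, symmetrized over pairs of agents. -/
lemma two_mul_sum_mul_velocity (hK : IsCooperative K) (x y : Profile n d) :
    2 * ∑ i, ∑ p, y i p * velocity F D s K x i p =
      -∑ i, ∑ j, ∑ p, (y j p - y i p) * influence F D s K x i j p := by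
  have h₁ : ∑ i, ∑ p, y i p * velocity F D s K x i p =
      ∑ i, ∑ j, ∑ p, y i p * influence F D s K x i j p := by
    refine Finset.sum_congr rfl fun i _ => ?_
    rw [Finset.sum_comm]
    simp only [velocity_eq_sum_influence, Finset.sum_apply, Finset.mul_sum]
  have h₂ : ∑ i, ∑ j, ∑ p, y i p * influence F D s K x i j p =
      -∑ i, ∑ j, ∑ p, y j p * influence F D s K x i j p := by
    rw [Finset.sum_comm]
    simp only [← Finset.sum_neg_distrib]
    refine Finset.sum_congr rfl fun j _ => Finset.sum_congr rfl fun i _ =>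
      Finset.sum_congr rfl fun p _ => ?_
    rw [influence_antisymm F D s hK x j i, Pi.neg_apply, mul_neg]
  simp only [sub_mul, Finset.sum_sub_distrib, h₁]
  linarith

lemma sum_velocity_apply_eq_zero (hK : IsCooperative K) (x : Profile n d) (p : Fin d) :
    ∑ i, velocity F D s K x i p = 0 := by
  have h := two_mul_sum_mul_velocity F D s hK x fun _ => Pi.single p 1
  simpa [Pi.single_apply] using h

/-- The quadratic form of `A^{i,j}` dominates its diagonal part, because the cross terms are
nonnegative. -/
lemma sum_diagonalWeight_mul_sq_le (hK : IsCooperative K) (x : Profile n d) (i j : Fin n) :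
    ∑ p, F.diagonalWeight s D (K i j p p) (x j p - x i p) * (x j p - x i p) ^ 2 ≤
      ∑ p, (x j p - x i p) * influence F D s K x i j p := by
  refine Finset.sum_le_sum fun p _ => ?_
  have hterm : ∀ q ∈ Finset.univ,
      0 ≤ (x j p - x i p) * (weight F D s K x i j p q * (x j q - x i q)) := by
    intro q _
    by_cases hpq : p = q
    · subst hpq
      have h := F.diagonalWeight_mul_sq_nonneg D s (hK.nonneg i j p p) (x j p - x i p)
      simp only [weight, Matrix.of_apply, if_true]
      linarith
    · simp only [weight, Matrix.of_apply, if_neg hpq]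
      exact F.mul_crossWeight_mul_nonneg s (hK.nonneg i j p q) _ _
  have h := Finset.single_le_sum hterm (Finset.mem_univ p)
  simp only [influence, Matrix.mulVec, dotProduct, Pi.sub_apply, Finset.mul_sum]
  refine le_of_eq_of_le ?_ h
  simp only [weight, Matrix.of_apply, if_true]
  ring

/-- Dissipation inequality: the left-hand side is the rate of change of the squared distance to
the profile in which all agents hold the opinions `m`. -/
lemma two_mul_sum_mul_velocity_le (hK : IsCooperative K) (x : Profile n d) (m : Fin d → ℝ) :
    2 * ∑ i, ∑ p, (x i p - m p) * velocity F D s K x i p ≤ -dissipation F D s K x := by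
  rw [two_mul_sum_mul_velocity F D s hK x fun i p => x i p - m p]
  simp only [sub_sub_sub_cancel_right]
  exact neg_le_neg (Finset.sum_le_sum fun i _ => Finset.sum_le_sum fun j _ =>
    sum_diagonalWeight_mul_sq_le F D s hK x i j)

lemma dissipation_nonneg (hK : IsCooperative K) (x : Profile n d) : 0 ≤ dissipation F D s K x :=
  Finset.sum_nonneg fun i _ => Finset.sum_nonneg fun j _ => Finset.sum_nonneg fun p _ =>
    F.diagonalWeight_mul_sq_nonneg D s (hK.nonneg i j p p) _

variable (K) in
lemma continuous_dissipation : Continuous (dissipation F D s K) := by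
  refine continuous_finsetSum _ fun i _ => continuous_finsetSum _ fun j _ =>
    continuous_finsetSum _ fun p _ => ?_
  have h : Continuous fun x : Profile n d => x j p - x i p := by fun_prop
  exact ((F.continuous_diagonalWeight D s (K i j p p)).comp h).mul (h.pow 2)

lemma eq_of_topicGraph_adj_of_dissipation_eq_zero (hK : IsCooperative K) {x : Profile n d}
    (hx : dissipation F D s K x = 0) {p : Fin d} {i j : Fin n} (hij : (topicGraph K p).Adj i j) :
    x i p = x j p := by
  have hnn := fun i j p =>
    F.diagonalWeight_mul_sq_nonneg D s (hK.nonneg i j p p) (x j p - x i p)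
  have hk : 0 < K i j p p := by
    refine (hK.nonneg i j p p).lt_of_ne' ?_
    rw [topicGraph, SimpleGraph.fromRel_adj, hK.symm_agents j i, or_self] at hij
    exact hij.2
  rw [dissipation, Fintype.sum_eq_zero_iff_of_nonneg
    fun i => Finset.sum_nonneg fun j _ => Finset.sum_nonneg fun p _ => hnn i j p] at hx
  have hi := congrFun hx i
  rw [Pi.zero_apply, Finset.sum_eq_zero_iff_of_nonneg
    fun j _ => Finset.sum_nonneg fun p _ => hnn i j p] at hi
  have hj := hi j (Finset.mem_univ j)
  rw [Finset.sum_eq_zero_iff_of_nonneg fun p _ => hnn i j p] at hj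
  have hp := hj p (Finset.mem_univ p)
  by_contra hne
  have hu : x j p - x i p ≠ 0 := sub_ne_zero.2 (Ne.symm hne)
  exact (mul_pos (F.diagonalWeight_pos D s hk hu) (by positivity)).ne' hp

/-- Only consensus profiles dissipate no energy, and the only one with mean `m` is the constant
profile `m`. -/
lemma dissipation_pos (hK : IsCooperative K) (hc : IsAllTopicCoupled K) {x : Profile n d}
    {m : Fin d → ℝ} (hm : ∀ p, ∑ i, (x i p - m p) = 0) (hne : ∃ i p, x i p ≠ m p) :
    0 < dissipation F D s K x := by
  refine (dissipation_nonneg F D s hK x).lt_of_ne' fun h0 => ?_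
  obtain ⟨i, p, hip⟩ := hne
  have hall : ∀ j, x j p = x i p := by
    intro j
    obtain ⟨w⟩ := (hc p).preconnected j i
    induction w with
    | nil => rfl
    | cons hadj _ ih =>
      exact (eq_of_topicGraph_adj_of_dissipation_eq_zero F D s hK h0 hadj).trans (ih hip)
  have hsum := hm p
  simp only [hall, Finset.sum_const, Finset.card_univ, Fintype.card_fin, nsmul_eq_mul,
    mul_eq_zero, Nat.cast_eq_zero] at hsum
  rcases hsum with hn | hsum
  · exact i.pos.ne' hn
  · exact hip (sub_eq_zero.1 hsum)

end Dissipation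

/-! ### Decay of the distance to the mean -/

/-- A function on `[t₀, ∞)` whose derivative is at most `-δ` decreases at least at rate `δ`. -/
lemma le_sub_mul_of_hasDerivWithinAt {f f' : ℝ → ℝ} {t₀ δ : ℝ}
    (hf : ∀ t ∈ Set.Ici t₀, HasDerivWithinAt f (f' t) (Set.Ici t₀) t)
    (hδ : ∀ t ∈ Set.Ici t₀, f' t ≤ -δ) {a b : ℝ} (ha : t₀ ≤ a) (hab : a ≤ b) :
    f b ≤ f a - δ * (b - a) := by
  have hg : ∀ t ∈ Set.Ici t₀,
      HasDerivWithinAt (fun t => f t + δ * t) (f' t + δ * 1) (Set.Ici t₀) t := fun t ht =>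
    (hf t ht).add ((hasDerivWithinAt_id t _).const_mul δ)
  have hanti : AntitoneOn (fun t => f t + δ * t) (Set.Ici t₀) :=
    antitoneOn_of_hasDerivWithinAt_nonpos (convex_Ici t₀)
      (fun t ht => (hg t ht).continuousWithinAt)
      (fun t ht => (hg t (interior_subset ht)).mono interior_subset)
      (fun t ht => by linarith [hδ t (interior_subset ht)])
  have h := hanti (Set.mem_Ici.2 ha) (Set.mem_Ici.2 (ha.trans hab)) hab
  simp only at h
  linarith

section Deviation

variable {n d : ℕ}

/-- The squared distance of a profile to the profile in which all agents hold the opinions `m`. -/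
def sqDeviation (m : Fin d → ℝ) (x : Profile n d) : ℝ :=
  ∑ i, ∑ p, (x i p - m p) ^ 2

lemma continuous_sqDeviation (m : Fin d → ℝ) :
    Continuous (sqDeviation m : Profile n d → ℝ) := by
  unfold sqDeviation
  fun_prop

lemma sq_sub_le_sqDeviation (m : Fin d → ℝ) (x : Profile n d) (i : Fin n) (p : Fin d) :
    (x i p - m p) ^ 2 ≤ sqDeviation m x :=
  (Finset.single_le_sum (f := fun p => (x i p - m p) ^ 2) (fun _ _ => sq_nonneg _)
    (Finset.mem_univ p)).trans
  (Finset.single_le_sum (f := fun i => ∑ p, (x i p - m p) ^ 2)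
    (fun _ _ => Finset.sum_nonneg fun _ _ => sq_nonneg _) (Finset.mem_univ i))

/-- The profiles with mean `m` whose squared deviation lies in a closed interval form a compact
set. -/
lemma isCompact_setOf_sqDeviation_mem_Icc (m : Fin d → ℝ) (a b : ℝ) :
    IsCompact {x : Profile n d | (∀ p, ∑ i, (x i p - m p) = 0) ∧
      sqDeviation m x ∈ Set.Icc a b} := by
  refine Metric.isCompact_of_isClosed_isBounded ?_ ?_
  · rw [Set.ofPred_and, Set.ofPred_forall]
    exact (isClosed_iInter fun p => isClosed_eq (by fun_prop) continuous_const).inter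
      (isClosed_Icc.preimage (continuous_sqDeviation m))
  · refine (Metric.isBounded_closedBall (x := fun _ => m) (r := √b)).subset fun x hx => ?_
    rw [Metric.mem_closedBall, dist_pi_le_iff (Real.sqrt_nonneg b)]
    intro i
    rw [dist_pi_le_iff (Real.sqrt_nonneg b)]
    intro p
    exact Real.abs_le_sqrt ((sq_sub_le_sqDeviation m x i p).trans hx.2.2)

variable {F : Feedback} {D : DiagonalForm} {s : SignFunction} {K : Coupling n d} {t₀ : ℝ}
  {x : ℝ → Profile n d}

lemma IsSolution.hasDerivWithinAt_apply (hx : IsSolution F D s K t₀ x) {t : ℝ}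
    (ht : t ∈ Set.Ici t₀) (i : Fin n) (p : Fin d) :
    HasDerivWithinAt (fun t => x t i p) (velocity F D s K (x t) i p) (Set.Ici t₀) t :=
  hasDerivWithinAt_pi.1 (hasDerivWithinAt_pi.1 (hx t ht) i) p

lemma IsSolution.sum_apply_eq (hK : IsCooperative K) (hx : IsSolution F D s K t₀ x) {t : ℝ}
    (ht : t₀ ≤ t) (p : Fin d) : ∑ i, x t i p = ∑ i, x t₀ i p := by
  have hd : ∀ t ∈ Set.Ici t₀, HasDerivWithinAt (fun t => ∑ i, x t i p) 0 (Set.Ici t₀) t := by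
    intro t ht
    rw [← sum_velocity_apply_eq_zero F D s hK (x t) p]
    exact HasDerivWithinAt.fun_sum fun i _ => hx.hasDerivWithinAt_apply ht i p
  have hle := le_sub_mul_of_hasDerivWithinAt (δ := 0) hd (by simp) le_rfl ht
  have hge := le_sub_mul_of_hasDerivWithinAt (δ := 0) (fun t ht => (hd t ht).neg) (by simp)
    le_rfl ht
  simp only [Pi.neg_apply] at hge
  linarith

lemma IsSolution.hasDerivWithinAt_sqDeviation (hx : IsSolution F D s K t₀ x) (m : Fin d → ℝ)
    {t : ℝ} (ht : t ∈ Set.Ici t₀) :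
    HasDerivWithinAt (fun t => sqDeviation m (x t))
      (2 * ∑ i, ∑ p, (x t i p - m p) * velocity F D s K (x t) i p) (Set.Ici t₀) t := by
  simp only [Finset.mul_sum]
  refine HasDerivWithinAt.fun_sum fun i _ => HasDerivWithinAt.fun_sum fun p _ => ?_
  refine (((hx.hasDerivWithinAt_apply ht i p).sub_const (m p)).pow 2).congr_deriv ?_
  simp [mul_assoc]

/-- Along a solution with mean `m`, the squared deviation from `m` tends to zero. -/
lemma IsSolution.tendsto_sqDeviation (hK : IsCooperative K) (hc : IsAllTopicCoupled K)
    (hx : IsSolution F D s K t₀ x) {m : Fin d → ℝ}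
    (hm : ∀ t ≥ t₀, ∀ p, ∑ i, (x t i p - m p) = 0) :
    Tendsto (fun t => sqDeviation m (x t)) atTop (𝓝 0) := by
  have hderiv := fun t (ht : t ∈ Set.Ici t₀) => hx.hasDerivWithinAt_sqDeviation m ht
  have hrate := fun t => two_mul_sum_mul_velocity_le F D s hK (x t) m
  have hanti : ∀ a b, t₀ ≤ a → a ≤ b → sqDeviation m (x b) ≤ sqDeviation m (x a) := by
    intro a b ha hab
    have h := le_sub_mul_of_hasDerivWithinAt (δ := 0) hderiv
      (fun t _ => by linarith [hrate t, dissipation_nonneg F D s hK (x t)]) ha hab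
    linarith
  have hnn : ∀ t, 0 ≤ sqDeviation m (x t) := fun t =>
    Finset.sum_nonneg fun _ _ => Finset.sum_nonneg fun _ _ => sq_nonneg _
  have hsmall : ∀ ε > 0, ∃ T ≥ t₀, sqDeviation m (x T) < ε := by
    intro ε hε
    by_contra! hbig
    obtain ⟨δ, hδ, hWδ⟩ :=
      (isCompact_setOf_sqDeviation_mem_Icc m ε (sqDeviation m (x t₀))).exists_forall_le'
        (continuous_dissipation F D s K).continuousOn (a := 0) fun y hy => by
          refine dissipation_pos F D s hK hc hy.1 ?_
          by_contra! h
          have h0 : sqDeviation m y = 0 := by simp [sqDeviation, h]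
          linarith [hy.2.1]
    -- At this time the linear decrease at rate `δ` has consumed the initial deviation.
    have hT : t₀ ≤ t₀ + sqDeviation m (x t₀) / δ :=
      le_add_of_nonneg_right (div_nonneg (hnn t₀) hδ.le)
    have h := le_sub_mul_of_hasDerivWithinAt (δ := δ) hderiv
      (fun t ht => (hrate t).trans
        (neg_le_neg (hWδ (x t) ⟨hm t ht, hbig t ht, hanti t₀ t le_rfl ht⟩))) le_rfl hT
    rw [add_sub_cancel_left, mul_div_cancel₀ _ hδ.ne', sub_self] at h
    linarith [hbig _ hT]
  rw [Metric.tendsto_atTop]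
  intro ε hε
  obtain ⟨T, hT, hTε⟩ := hsmall ε hε
  refine ⟨T, fun t ht => ?_⟩
  rw [Real.dist_0_eq_abs, abs_of_nonneg (hnn t)]
  exact (hanti T t hT ht).trans_lt hTε

end Deviation

end OpinionDynamics

open OpinionDynamics in
theorem mainTheorem3 {n d : ℕ} (F : OpinionDynamics.Feedback) (D : OpinionDynamics.DiagonalForm)
    (s : OpinionDynamics.SignFunction) (K : OpinionDynamics.Coupling n d)
    (hK : OpinionDynamics.IsCooperative K) (hcoupled : OpinionDynamics.IsAllTopicCoupled K)
    (t₀ : ℝ) (x : ℝ → OpinionDynamics.Profile n d)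
    (hx : OpinionDynamics.IsSolution F D s K t₀ x) :
    OpinionDynamics.ReachesCompleteConsensus x := by
  set m : Fin d → ℝ := fun p => (∑ i, x t₀ i p) / n with hm
  refine ⟨m, fun i p => ?_⟩
  have hn : (n : ℝ) ≠ 0 := Nat.cast_ne_zero.2 i.pos.ne'
  have hV := hx.tendsto_sqDeviation hK hcoupled (m := m) fun t ht p => by
    rw [Finset.sum_sub_distrib, hx.sum_apply_eq hK ht p]
    simp [hm, mul_div_cancel₀ _ hn]
  have hsqrt := hV.sqrt
  rw [Real.sqrt_zero] at hsqrt
  rw [tendsto_iff_dist_tendsto_zero]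
  exact squeeze_zero (fun _ => dist_nonneg)
    (fun t => Real.abs_le_sqrt (sq_sub_le_sqDeviation m (x t) i p)) hsqrt
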